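/- Let $p$ be a prime, $k\ge 2$, $\alpha\ge 1$ and $\beta\ge 1$ integers with $\gcd(\beta,p)=1$. Let $$R_{\alpha,\beta}=\mathbb{Z}_p[x]/(x^\alpha-1)\times\mathbb{Z}_{p^k}[x]/(x^\beta-1)$$ be the $\mathbb{Z}_{p^k}[x]$-module with $h\star(c_1,c_2)=(\overline h\,c_1,h\,c_2)$, where $\overline h$ is the reduction of $h$ modulo $p$; it is a $\mathbb{Z}_{p^k}$-module through the constant polynomials. Let $a,b\in\mathbb{Z}_p[x]$ with $a\mid x^\alpha-1$, and let $f_0,\dots,f_{k-1}\in\mathbb{Z}_{p^k}[x]$ have leading coefficients that are units (for example monic polynomials), with $f_{k-1}\mid f_{k-2}\mid\cdots\mid f_1\mid f_0\mid x^\beta-1$. Put $f=f_0+pf_1+\cdots+p^{k-1}f_{k-1}$, $t_i=\deg f_i$, $t_a=\deg a$, and let $h_j$ be given by $h_jf_j=x^\beta-1$ in $\mathbb{Z}_{p^k}[x]$ for $0\le j\le k-1$. Assume $a\mid\overline{h_{k-1}}\,b$ in $\mathbb{Z}_p[x]$. Let $\mathcal{C}=\langle(a,0),(b,f)\rangle$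 be the $\mathbb{Z}_{p^k}[x]$-submodule of $R_{\alpha,\beta}$ generated by $(a,0)$ and $(b,f)$, that is, the $\mathbb{Z}_p\mathbb{Z}_{p^k}$-additive cyclic code generated by these two words. Define $$T_1=\{x^i\star(a,0):0\le i\le\alpha-t_a-1\},\qquad T_2=\{x^i\star(b,f):0\le i\le\beta-t_0-1\},$$ $$S_j=\{x^i\star(\overline{h_j}\,b,h_jf):0\le i\le t_j-t_{j+1}-1\}\qquad(0\le j\le k-2).$$ **(1)** $S=T_1\cup T_2\cup S_0\cup\cdots\cup S_{k-2}$ is a minimal spanning set of $\mathcal{C}$ as a $\mathbb{Z}_{p^k}$-module: it spans $\mathcal{C}$, and no proper subset of $S$ does. **(2)** Say that $\mathcal{C}$ has type parameters $(\gamma_0,\dots,\gamma_k)$, where the $\gamma_i\ge 0$ are integers, if there is an isomorphism of groups $$\mathcal{C}\cong\mathbb{Z}_p^{\gamma_0+\gamma_k}\times\mathbb{Z}_{p^k}^{\gamma_1}\times\mathbb{Z}_{p^{k-1}}^{\gamma_2}\times\cdots\times\mathbb{Z}_{p^2}^{\gamma_{k-1}}.$$ Then $\mathcal{C}$ has the type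 parameters $$\gamma_0=\alpha-t_a,\qquad\gamma_1=\beta-t_0,\qquad\gamma_i=t_{i-2}-t_{i-1}\quad(2\le i\le k),$$ and these are the only type parameters of $\mathcal{C}$ for which $\gamma_0$ is the dimension over $\mathbb{Z}_p$ of $\{u:(u,0)\in\mathcal{C}\}$. Moreover, any type parameters of $\mathcal{C}$ satisfy $\gamma_1=\beta-t_0$, $\gamma_i=t_{i-2}-t_{i-1}$ for $2\le i\le k-1$, and $\gamma_0+\gamma_k=(\alpha-t_a)+(t_{k-2}-t_{k-1})$. -/

import Mathlib

open Polynomial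

noncomputable section

/-- The ring `(ℤ/q)[x]/(x^n - 1)`. For `n ≥ 1` it is the space `(ℤ/q)^n` of words of length `n`,
on which multiplication by `x` is the cyclic shift. -/
abbrev CycRing (q n : ℕ) : Type :=
  (ZMod q)[X] ⧸ Ideal.span {(X ^ n - 1 : (ZMod q)[X])}

/-- The class of a polynomial in `(ℤ/q)[x]/(x^n - 1)`. -/
abbrev cyc (q n : ℕ) : (ZMod q)[X] →+* CycRing q n :=
  Ideal.Quotient.mk (Ideal.span {(X ^ n - 1 : (ZMod q)[X])})

/-- The reduction `h ↦ h mod p` from `(ℤ/p^k)[x]` to `(ℤ/p)[x]`. -/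
def redPoly (p k : ℕ) [k.AtLeastTwo] : (ZMod (p ^ k))[X] →+* (ZMod p)[X] :=
  Polynomial.mapRingHom (ZMod.castHom (dvd_pow_self p (NeZero.ne k)) (ZMod p))

/-- The ambient space `(ℤ/p)[x]/(x^α - 1) × (ℤ/p^k)[x]/(x^β - 1)`. -/
def MixedSpace (p k α β : ℕ) : Type :=
  CycRing p α × CycRing (p ^ k) β

namespace MixedSpace

variable {p k α β : ℕ}

instance : AddCommGroup (MixedSpace p k α β) :=
  inferInstanceAs (AddCommGroup (CycRing p α × CycRing (p ^ k) β))

/-- The word represented by a pair of polynomials. -/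
def word (u : (ZMod p)[X]) (v : (ZMod (p ^ k))[X]) : MixedSpace p k α β :=
  (cyc p α u, cyc (p ^ k) β v)

/-- The multiplication `h ⋆ (c₁, c₂) = (h̄ c₁, h c₂)`. -/
def star [k.AtLeastTwo] (h : (ZMod (p ^ k))[X]) (c : MixedSpace p k α β) :
    MixedSpace p k α β :=
  (cyc p α (redPoly p k h) * c.1, cyc (p ^ k) β h * c.2)

/-- The `(ℤ/p^k)[x]`-module structure given by `⋆`. -/
instance [k.AtLeastTwo] : Module (ZMod (p ^ k))[X] (MixedSpace p k α β) where
  smul := star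
  one_smul c := Prod.ext
    (show cyc p α (redPoly p k 1) * c.1 = c.1 by rw [map_one, map_one, one_mul])
    (show cyc (p ^ k) β 1 * c.2 = c.2 by rw [map_one, one_mul])
  mul_smul g h c := Prod.ext
    (show cyc p α (redPoly p k (g * h)) * c.1
      = cyc p α (redPoly p k g) * (cyc p α (redPoly p k h) * c.1) by
        rw [map_mul, map_mul, mul_assoc])
    (show cyc (p ^ k) β (g * h) * c.2 = cyc (p ^ k) β g * (cyc (p ^ k) β h * c.2) by
        rw [map_mul, mul_assoc])
  smul_zero g := Prod.ext (mul_zero _) (mul_zero _)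
  smul_add g c d := Prod.ext (mul_add _ _ _) (mul_add _ _ _)
  add_smul g h c := Prod.ext
    (show cyc p α (redPoly p k (g + h)) * c.1
      = cyc p α (redPoly p k g) * c.1 + cyc p α (redPoly p k h) * c.1 by
        rw [map_add, map_add, add_mul])
    (show cyc (p ^ k) β (g + h) * c.2 = cyc (p ^ k) β g * c.2 + cyc (p ^ k) β h * c.2 by
        rw [map_add, add_mul])
  zero_smul c := Prod.ext
    (show cyc p α (redPoly p k 0) * c.1 = 0 by rw [map_zero, map_zero, zero_mul])
    (show cyc (p ^ k) β 0 * c.2 = 0 by rw [map_zero, zero_mul])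

/-- The `ℤ/p^k`-module structure: scalars act as constant polynomials. -/
instance [k.AtLeastTwo] : Module (ZMod (p ^ k)) (MixedSpace p k α β) :=
  Module.compHom _ (Polynomial.C : ZMod (p ^ k) →+* (ZMod (p ^ k))[X])

instance [k.AtLeastTwo] :
    IsScalarTower (ZMod (p ^ k)) (ZMod (p ^ k))[X] (MixedSpace p k α β) where
  smul_assoc r g c := by
    rw [Polynomial.smul_eq_C_mul, mul_smul]
    rfl

end MixedSpace

/-- The code `⟨(a, 0), (b, f)⟩`, i.e. the `(ℤ/p^k)[x]`-submodule generated by the two words. -/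
def cyclicCode (p k α β : ℕ) [k.AtLeastTwo] (a b : (ZMod p)[X]) (f : (ZMod (p ^ k))[X]) :
    Submodule (ZMod (p ^ k))[X] (MixedSpace p k α β) :=
  Submodule.span _ {MixedSpace.word a 0, MixedSpace.word b f}

/-- `S` spans the code `C` over `ℤ/p^k`, and no proper subset of `S` does. -/
def IsMinimalSpanningSet {p k α β : ℕ} [k.AtLeastTwo] (S : Set (MixedSpace p k α β))
    (C : Submodule (ZMod (p ^ k))[X] (MixedSpace p k α β)) : Prop :=
  Minimal (fun S' : Set (MixedSpace p k α β) =>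
    Submodule.span (ZMod (p ^ k)) S' = C.restrictScalars (ZMod (p ^ k))) S

/-- The additive group `C` is isomorphic to
`(ℤ/p)^(γ₀ + γ_k) × (ℤ/p^k)^(γ₁) × (ℤ/p^(k-1))^(γ₂) × ⋯ × (ℤ/p^2)^(γ_{k-1})`;
the index `i : Fin (k - 1)` stands for the factor with exponent `γ_{i+1}`. -/
def HasType {p k α β : ℕ} [k.AtLeastTwo]
    (C : Submodule (ZMod (p ^ k))[X] (MixedSpace p k α β)) (γ : ℕ → ℕ) : Prop :=
  Nonempty (C ≃+ (Fin (γ 0 + γ k) → ZMod p) ×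
    ((i : Fin (k - 1)) → Fin (γ (i + 1)) → ZMod (p ^ (k - i))))

/-- The `p`-ary linear code `{u | (u, 0) ∈ C}`. -/
def pureSubcode {p k α β : ℕ} [k.AtLeastTwo]
    (C : Submodule (ZMod (p ^ k))[X] (MixedSpace p k α β)) :
    Submodule (ZMod p) (CycRing p α) where
  carrier := {u | ((u, 0) : CycRing p α × CycRing (p ^ k) β) ∈ (C : Set (MixedSpace p k α β))}
  zero_mem' := C.zero_mem
  add_mem' {u v} hu hv := by
    have h := C.add_mem hu hv
    have e : ((u + v, 0) : CycRing p α × CycRing (p ^ k) β) = (u, 0) + (v, 0) := by simp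
    exact (congrArg (· ∈ (C : Set (MixedSpace p k α β))) e).mpr h
  smul_mem' r u hu := by
    obtain ⟨s, rfl⟩ := ZMod.ringHom_surjective
      (ZMod.castHom (dvd_pow_self p (NeZero.ne k)) (ZMod p)) r
    have h := C.smul_mem (Polynomial.C s) hu
    have e : ((ZMod.castHom (dvd_pow_self p (NeZero.ne k)) (ZMod p) s • u, 0) :
        CycRing p α × CycRing (p ^ k) β)
        = (cyc p α (redPoly p k (Polynomial.C s)) * u, cyc (p ^ k) β (Polynomial.C s) * 0) := by
      refine Prod.ext ?_ (mul_zero _).symm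
      obtain ⟨q, rfl⟩ := Ideal.Quotient.mk_surjective u
      simp only [redPoly, Polynomial.coe_mapRingHom, Polynomial.map_C]
      rw [← map_mul, ← Polynomial.smul_eq_C_mul]
      rfl
    exact (congrArg (· ∈ (C : Set (MixedSpace p k α β))) e).mpr h

/-- `{x^i ⋆ c | 0 ≤ i ≤ n - 1}`. -/
def shifts {p k α β : ℕ} [k.AtLeastTwo] (c : MixedSpace p k α β) (n : ℕ) :
    Set (MixedSpace p k α β) :=
  {w | ∃ i < n, w = (X ^ i : (ZMod (p ^ k))[X]) • c}

/-- `f₀ + p f₁ + ⋯ + p^(k-1) f_{k-1}`. -/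
def padicSum (p k : ℕ) (f : ℕ → (ZMod (p ^ k))[X]) : (ZMod (p ^ k))[X] :=
  ∑ i ∈ Finset.range k, (p : (ZMod (p ^ k))[X]) ^ i * f i

/-- The set `T₁ ∪ T₂ ∪ S₀ ∪ ⋯ ∪ S_{k-2}`. -/
def spanningSet (p k α β : ℕ) [k.AtLeastTwo] (a b : (ZMod p)[X])
    (f h : ℕ → (ZMod (p ^ k))[X]) : Set (MixedSpace p k α β) :=
  shifts (MixedSpace.word a 0) (α - a.natDegree) ∪
  shifts (MixedSpace.word b (padicSum p k f)) (β - (f 0).natDegree) ∪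
  ⋃ j ∈ Finset.range (k - 1),
    shifts (MixedSpace.word (redPoly p k (h j) * b) (h j * padicSum p k f))
      ((f j).natDegree - (f (j + 1)).natDegree)

end

/-! The words of the spanning set turn out to generate cyclic groups whose direct sum is the code:
order `p` for T₁, `p^k` for T₂ and `p^(k-1-j)` for S_j. Both the minimality and the type follow from
this.

Relations. The cofactor `h_j` kills `f_0, …, f_j` modulo `x^β - 1`, so `h_j f ≡ p^(j+1) h_j (f_{j+1}
+ p f_{j+2} + ⋯)`. After removal of the powers of `p`, the second components are polynomials of
degree less than `β` (`tailWord`), whose reductions modulo `p` are `x^i f_0` and `x^i h_j f_{j+1}`.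
These are independent over the field because `x^β - 1` is separable, which makes `f_j / f_{j+1}`
coprime to `h_j` (`eq_zero_of_chain_relation`). Independence lifts to `ℤ/p^k`. Hence in any relation
the coefficient of a word in T₂ or S_j is divisible by the order of that word. In particular it
vanishes modulo `p`, so `b` disappears from the first component, and the remaining multiples of `a`
have degree less than `α`. The only relations are therefore the orders
(`pow_genExp_dvd_of_sum_eq_zero`). None has a unit coefficient, which gives minimality.

Spanning. Dividing a polynomial successively by `h_0` and by the quotients `h_{j+1} / h_j` writes it
as an admissible combination plus a multiple of `h_{k-1}`. That multiple kills `f` and sends `b`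
into the ideal of `a`, so it contributes only multiples of `(a, 0)` (`span_range_gen`).

Type. The sizes of the `p^m`-torsion determine how many cyclic factors of each order occur. Factors
of order `p` come from both T₁ and S_{k-2}, so the group alone sees only `γ₀ + γ_k`; the dimension
of `{u | (u, 0) ∈ C}` separates the two. -/

/-! ### Finite products of cyclic `p`-groups -/

/-- The `p^m`-torsion of a product of cyclic `p`-groups. -/
theorem card_ker_nsmul_pi_zmod {ι : Type*} [Fintype ι] {p : ℕ} (hp : p.Prime) (e : ι → ℕ) (m : ℕ) :
    Nat.card (nsmulAddMonoidHom (p ^ m) : ((i : ι) → ZMod (p ^ e i)) →+ _).ker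
      = p ^ ∑ i, min (e i) m := by
  have hne : ∀ i, NeZero (p ^ e i) := fun i => ⟨pow_ne_zero _ hp.ne_zero⟩
  have E : (nsmulAddMonoidHom (p ^ m) : ((i : ι) → ZMod (p ^ e i)) →+ _).ker ≃
      ((i : ι) → (nsmulAddMonoidHom (p ^ m) : ZMod (p ^ e i) →+ _).ker) :=
    { toFun := fun x i => ⟨x.1 i, by simpa using congrFun (AddMonoidHom.mem_ker.1 x.2) i⟩
      invFun := fun x => ⟨fun i => (x i).1,
        AddMonoidHom.mem_ker.2 (funext fun i => AddMonoidHom.mem_ker.1 (x i).2)⟩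
      left_inv := fun _ => rfl
      right_inv := fun _ => rfl }
  rw [Nat.card_congr E, Nat.card_pi, ← Finset.prod_pow_eq_pow_sum]
  refine Finset.prod_congr rfl fun i _ => ?_
  rw [IsAddCyclic.card_nsmulAddMonoidHom_ker, Nat.card_zmod]
  rcases le_total (e i) m with h | h
  · rw [min_eq_left h, Nat.gcd_eq_left (pow_dvd_pow p h)]
  · rw [min_eq_right h, Nat.gcd_eq_right (pow_dvd_pow p h)]

/-- Isomorphic products of nontrivial cyclic `p`-groups have the same number of factors of each
order. -/
theorem count_eq_of_pi_zmod_addEquiv {ι κ : Type*} [Fintype ι] [Fintype κ] {p : ℕ} (hp : p.Prime)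
    {e : ι → ℕ} {e' : κ → ℕ} (he : ∀ i, 1 ≤ e i) (he' : ∀ i, 1 ≤ e' i)
    (E : ((i : ι) → ZMod (p ^ e i)) ≃+ ((i : κ) → ZMod (p ^ e' i))) (m : ℕ) :
    (∑ i, if e i = m then 1 else 0) = ∑ i, if e' i = m then 1 else 0 := by
  have key : ∀ m, ∑ i, min (e i) m = ∑ i, min (e' i) m := fun m => by
    refine Nat.pow_right_injective hp.two_le ?_
    simp only
    rw [← card_ker_nsmul_pi_zmod hp e m, ← card_ker_nsmul_pi_zmod hp e' m]
    refine Nat.card_congr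
      { toFun := fun x => ⟨E x.1, ?_⟩
        invFun := fun x => ⟨E.symm x.1, ?_⟩
        left_inv := fun x => by simp
        right_inv := fun x => by simp }
    · have := AddMonoidHom.mem_ker.1 x.2
      rw [nsmulAddMonoidHom_apply] at this
      rw [AddMonoidHom.mem_ker, nsmulAddMonoidHom_apply, ← map_nsmul, this, map_zero]
    · have := AddMonoidHom.mem_ker.1 x.2
      rw [nsmulAddMonoidHom_apply] at this
      rw [AddMonoidHom.mem_ker, nsmulAddMonoidHom_apply, ← map_nsmul, this, map_zero]
  -- Torsion cannot detect trivial factors, so exponent zero has to be excluded by `he` and `he'`.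
  rcases m with _ | m
  · rw [Finset.sum_eq_zero, Finset.sum_eq_zero]
    · intro i _; have := he' i; rw [if_neg]; omega
    · intro i _; have := he i; rw [if_neg]; omega
  -- The second difference of `min x ·` at `m + 1` is minus the indicator of `x = m + 1`; summing
  -- recovers the multiplicity from three torsion exponents.
  · have id1 : ∀ x : ℕ, (if x = m + 1 then 1 else 0) + (min x m + min x (m + 2))
        = 2 * min x (m + 1) := fun x => by split_ifs <;> omega
    have h1 := Finset.sum_congr (rfl : (Finset.univ : Finset ι) = _) fun i _ => id1 (e i)
    have h2 := Finset.sum_congr (rfl : (Finset.univ : Finset κ) = _) fun i _ => id1 (e' i)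
    simp only [Finset.sum_add_distrib, ← Finset.mul_sum] at h1 h2
    have := key m
    have := key (m + 1)
    have := key (m + 2)
    omega

/-- Products of cyclic groups with the same number of factors of each order are isomorphic. -/
theorem nonempty_pi_zmod_addEquiv_of_count_eq {ι κ : Type*} [Fintype ι] [Fintype κ] (p : ℕ)
    {e : ι → ℕ} {e' : κ → ℕ}
    (h : ∀ m, (∑ i, if e i = m then 1 else 0) = ∑ i, if e' i = m then 1 else 0) :
    Nonempty (((i : ι) → ZMod (p ^ e i)) ≃+ ((i : κ) → ZMod (p ^ e' i))) := by
  classical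
  have F : ∀ m, Nonempty ({i // e i = m} ≃ {i // e' i = m}) := fun m => by
    refine ⟨Fintype.equivOfCardEq ?_⟩
    rw [Fintype.card_subtype, Fintype.card_subtype, Finset.card_filter, Finset.card_filter]
    exact h m
  let σ : ι ≃ κ := Equiv.ofFiberEquiv fun m => (F m).some
  have hσ : ∀ i, e' (σ i) = e i := fun i => Equiv.ofFiberEquiv_map _ i
  exact ⟨(AddEquiv.piCongrRight fun i =>
    (ZMod.ringEquivCongr (congrArg (p ^ ·) (hσ i).symm)).toAddEquiv).trans
    (RingEquiv.piCongrLeft (fun j => ZMod (p ^ e' j)) σ).toAddEquiv⟩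

/-! ### Reduction modulo `p` -/

/-- The reduction `ℤ/p^k → ℤ/p`. -/
abbrev modP (p k : ℕ) [NeZero k] : ZMod (p ^ k) →+* ZMod p :=
  ZMod.castHom (dvd_pow_self p (NeZero.ne k)) (ZMod p)

theorem modP_eq_zero_iff {p k : ℕ} [NeZero k] [NeZero (p ^ k)] (c : ZMod (p ^ k)) :
    modP p k c = 0 ↔ (p : ZMod (p ^ k)) ∣ c := by
  constructor
  · intro h
    rw [← ZMod.natCast_zmod_val c, map_natCast, ZMod.natCast_eq_zero_iff] at h
    obtain ⟨d, hd⟩ := h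
    exact ⟨d, by rw [← ZMod.natCast_zmod_val c, hd, Nat.cast_mul]⟩
  · rintro ⟨d, rfl⟩
    rw [map_mul, map_natCast, ZMod.natCast_self, zero_mul]

theorem pow_dvd_of_pow_mul_eq_zero {p k m : ℕ} (hp : 0 < p) (hm : m ≤ k) {c : ZMod (p ^ k)}
    (h : (p : ZMod (p ^ k)) ^ m * c = 0) : (p : ZMod (p ^ k)) ^ (k - m) ∣ c := by
  have : NeZero (p ^ k) := ⟨(pow_pos hp k).ne'⟩
  obtain ⟨n, rfl⟩ := ZMod.natCast_zmod_surjective c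
  rw [← Nat.cast_pow, ← Nat.cast_mul, ZMod.natCast_eq_zero_iff] at h
  obtain ⟨l, rfl⟩ := Nat.exists_eq_add_of_le hm
  rw [pow_add, Nat.mul_dvd_mul_iff_left (pow_pos hp m)] at h
  rw [Nat.add_sub_cancel_left, ← Nat.cast_pow]
  exact Nat.cast_dvd_cast h

theorem natCast_pow_self_eq_zero (p k : ℕ) : (p : ZMod (p ^ k)) ^ k = 0 := by
  rw [← Nat.cast_pow, ZMod.natCast_self]

theorem modP_eq_zero_of_pow_mul_eq_zero {p k m : ℕ} [NeZero k] (hp : 0 < p) (hm : m < k)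
    {c : ZMod (p ^ k)} (h : (p : ZMod (p ^ k)) ^ m * c = 0) : modP p k c = 0 := by
  have : NeZero (p ^ k) := ⟨(pow_pos hp k).ne'⟩
  rw [modP_eq_zero_iff]
  exact (dvd_pow_self _ (by omega)).trans (pow_dvd_of_pow_mul_eq_zero hp hm.le h)

/-- Polynomials over `ℤ/p^k` whose reductions modulo `p` are linearly independent are linearly
independent. -/
theorem linearIndependent_of_map_modP {ι : Type*} [Fintype ι] {p k : ℕ} [NeZero k] (hp : 0 < p)
    {w : ι → (ZMod (p ^ k))[X]}
    (hw : LinearIndependent (ZMod p) fun i => (w i).map (modP p k)) :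
    LinearIndependent (ZMod (p ^ k)) w := by
  have : NeZero (p ^ k) := ⟨(pow_pos hp k).ne'⟩
  rw [Fintype.linearIndependent_iff] at hw ⊢
  intro c hc
  -- Once `p^m` is divided out of all coefficients, the remaining combination is killed by `p^m`
  -- with `m < k`, so it vanishes modulo `p`, and independence there yields one more factor `p`.
  have step : ∀ m ≤ k, ∀ i, (p : ZMod (p ^ k)) ^ m ∣ c i := by
    intro m
    induction m with
    | zero => intro _ i; simp
    | succ m ih =>
      intro hm
      choose d hd using ih (by omega)
      have h0 : C ((p : ZMod (p ^ k)) ^ m) * ∑ i, d i • w i = 0 := by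
        rw [← hc, Finset.mul_sum]
        refine Finset.sum_congr rfl fun i _ => ?_
        rw [hd i, smul_eq_C_mul, smul_eq_C_mul, C_mul, mul_assoc]
      have h1 : (∑ i, d i • w i).map (modP p k) = 0 := by
        ext n
        rw [coeff_map, coeff_zero]
        refine modP_eq_zero_of_pow_mul_eq_zero hp (m := m) (by omega) ?_
        rw [← coeff_C_mul, h0, coeff_zero]
      have h2 : ∑ i, modP p k (d i) • (w i).map (modP p k) = 0 := by
        rw [← h1, Polynomial.map_sum]
        refine Finset.sum_congr rfl fun i _ => ?_
        rw [Polynomial.map_smul]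
      intro i
      obtain ⟨e, he⟩ := (modP_eq_zero_iff _).1 (hw _ h2 i)
      exact ⟨e, by rw [hd i, he, pow_succ, mul_assoc]⟩
  intro i
  obtain ⟨d, hd⟩ := step k le_rfl i
  rw [hd, natCast_pow_self_eq_zero, zero_mul]

/-- A `ℤ/p^k`-module spanned by elements `v i` of order `p^(e i)`, between which there are no
relations other than these orders, is a product of cyclic groups. -/
theorem nonempty_span_addEquiv_pi_zmod {ι M : Type*} [Fintype ι] [AddCommGroup M] {p k : ℕ}
    [Module (ZMod (p ^ k)) M] (v : ι → M) (e : ι → ℕ) (he : ∀ i, e i ≤ k)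
    (hv : ∀ i, (p : ZMod (p ^ k)) ^ e i • v i = 0)
    (hrel : ∀ c : ι → ZMod (p ^ k), ∑ i, c i • v i = 0 → ∀ i, (p : ZMod (p ^ k)) ^ e i ∣ c i) :
    Nonempty (Submodule.span (ZMod (p ^ k)) (Set.range v) ≃+ ((i : ι) → ZMod (p ^ e i))) := by
  let φ : (ι → ZMod (p ^ k)) →+ M := (Fintype.linearCombination (ZMod (p ^ k)) v).toAddMonoidHom
  let ψ : (ι → ZMod (p ^ k)) →+ ((i : ι) → ZMod (p ^ e i)) :=
    { toFun := fun c i => ZMod.castHom (pow_dvd_pow p (he i)) (ZMod (p ^ e i)) (c i)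
      map_zero' := funext fun i => map_zero _
      map_add' := fun c d => funext fun i => map_add _ _ _ }
  have hψ : Function.Surjective ψ := fun y => by
    choose c hc using fun i =>
      ZMod.ringHom_surjective (ZMod.castHom (pow_dvd_pow p (he i)) (ZMod (p ^ e i))) (y i)
    exact ⟨c, funext hc⟩
  have hφ : ∀ c, φ c = ∑ i, c i • v i := fun c => rfl
  -- Both groups are quotients of the free module: `hrel` gives one inclusion of kernels and the
  -- orders `hv` give the other.
  have hker : φ.ker = ψ.ker := by
    ext c
    rw [AddMonoidHom.mem_ker, AddMonoidHom.mem_ker, hφ]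
    constructor
    · intro h
      funext i
      obtain ⟨d, hd⟩ := hrel c h i
      change ZMod.castHom (pow_dvd_pow p (he i)) (ZMod (p ^ e i)) (c i) = 0
      rw [hd, map_mul, map_pow, map_natCast, natCast_pow_self_eq_zero, zero_mul]
    · intro h
      refine Finset.sum_eq_zero fun i _ => ?_
      have h1 : ZMod.castHom (pow_dvd_pow p (he i)) (ZMod (p ^ e i)) (c i) = 0 := congrFun h i
      obtain ⟨n, hn⟩ := ZMod.intCast_surjective (c i)
      rw [← hn, map_intCast, ZMod.intCast_zmod_eq_zero_iff_dvd] at h1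
      obtain ⟨d, hd⟩ := h1
      rw [← hn, hd]
      push_cast
      rw [mul_comm, mul_smul, hv, smul_zero]
  have hrange : (Submodule.span (ZMod (p ^ k)) (Set.range v)).toAddSubgroup = φ.range := by
    rw [← Fintype.range_linearCombination]
    rfl
  exact ⟨(AddEquiv.addSubgroupCongr hrange).trans
    ((QuotientAddGroup.quotientKerEquivRange φ).symm.trans
    ((QuotientAddGroup.quotientAddEquivOfEq hker).trans
      (QuotientAddGroup.quotientKerEquivOfSurjective ψ hψ)))⟩

/-- Elements `v i` between which no relation has a unit coefficient span minimally. -/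
theorem minimal_span_range {ι M R : Type*} [Fintype ι] [AddCommGroup M] [Ring R] [Module R M]
    (v : ι → M) (hrel : ∀ c : ι → R, ∑ i, c i • v i = 0 → ∀ i, ¬ IsUnit (c i)) :
    Minimal (fun S : Set M => Submodule.span R S = Submodule.span R (Set.range v))
      (Set.range v) := by
  classical
  refine ⟨rfl, fun S hS hle => ?_⟩
  rintro _ ⟨i, rfl⟩
  by_contra hi
  have hmem : v i ∈ Submodule.span R (v '' {j | j ≠ i}) := by
    have h1 : v i ∈ Submodule.span R S := hS ▸ Submodule.subset_span ⟨i, rfl⟩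
    refine Submodule.span_mono ?_ h1
    intro s hs
    obtain ⟨j, rfl⟩ := hle hs
    refine ⟨j, ?_, rfl⟩
    rintro rfl
    exact hi hs
  rw [Finsupp.mem_span_image_iff_linearCombination] at hmem
  obtain ⟨l, hl, hx⟩ := hmem
  have hli : l i = 0 := by
    by_contra h0
    exact hl (Finsupp.mem_support_iff.2 h0) rfl
  -- Moving `v i` to the other side gives a relation whose coefficient at `i` is `-1`, a unit.
  refine hrel (fun j => l j - if j = i then 1 else 0) ?_ i ?_
  · rw [Finsupp.linearCombination_apply, Finsupp.sum_fintype l _ (by simp)] at hx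
    simp [sub_smul, Finset.sum_sub_distrib, hx, ite_smul]
  · simp [hli]

/-! ### Polynomials with unit leading coefficient -/

/-- A unit is not a zero divisor, so degrees still add over `ℤ/p^k`, which is not a domain. -/
theorem natDegree_mul_of_isUnit {R : Type*} [CommRing R] [Nontrivial R] {u v : R[X]}
    (hv : IsUnit v.leadingCoeff) (hu : u ≠ 0) :
    (u * v).natDegree = u.natDegree + v.natDegree := by
  refine natDegree_mul' fun h => hu ?_
  rw [← leadingCoeff_eq_zero]
  exact (hv.mul_left_eq_zero).1 h

theorem natDegree_le_of_dvd_of_isUnit {R : Type*} [CommRing R] [Nontrivial R] {u v : R[X]}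
    (hu : IsUnit u.leadingCoeff) (hv : v ≠ 0) (h : u ∣ v) : u.natDegree ≤ v.natDegree := by
  obtain ⟨q, rfl⟩ := h
  rw [mul_comm, natDegree_mul_of_isUnit hu (right_ne_zero_of_mul hv)]
  exact Nat.le_add_left _ _

theorem isUnit_leadingCoeff_of_mul {R : Type*} [CommRing R] [Nontrivial R] {u v : R[X]}
    (hv : IsUnit v.leadingCoeff) (huv : IsUnit (u * v).leadingCoeff) :
    IsUnit u.leadingCoeff := by
  have hu : u ≠ 0 := by
    rintro rfl
    simp at huv
  rw [leadingCoeff_mul' fun h => hu (leadingCoeff_eq_zero.1 ((hv.mul_left_eq_zero).1 h))] at huv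
  exact isUnit_of_mul_isUnit_left huv

theorem eq_zero_of_mul_eq_zero_of_isUnit {R : Type*} [CommRing R] {u v : R[X]}
    (hv : IsUnit v.leadingCoeff) (h : u * v = 0) : u = 0 := by
  rw [← leadingCoeff_eq_zero]
  by_contra hne
  have := leadingCoeff_mul' (p := u) (q := v) fun h' => hne ((hv.mul_left_eq_zero).1 h')
  rw [h, leadingCoeff_zero] at this
  exact hne ((hv.mul_left_eq_zero).1 this.symm)

/-- Division with remainder by a polynomial with unit leading coefficient. -/
theorem exists_eq_mul_add_degree_lt {R : Type*} [CommRing R] [Nontrivial R] {v : R[X]}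
    (hv : IsUnit v.leadingCoeff) (u : R[X]) :
    ∃ q r : R[X], u = q * v + r ∧ r.degree < v.natDegree := by
  obtain ⟨c, hc⟩ := hv.exists_left_inv
  have hv0 : v ≠ 0 := by
    rintro rfl
    simp at hv
  have hmonic : (C c * v).Monic := monic_C_mul_of_mul_leadingCoeff_eq_one hc
  refine ⟨(u /ₘ (C c * v)) * C c, u %ₘ (C c * v), ?_, ?_⟩
  · conv_lhs => rw [← modByMonic_add_div u (C c * v)]
    ring
  · refine (degree_modByMonic_lt u hmonic).trans_le ?_
    rw [← degree_eq_natDegree hv0]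
    refine (degree_mul_le _ _).trans ?_
    exact (add_le_add_left degree_C_le _).trans_eq (zero_add _)

theorem sum_C_mul_X_pow_eq_ofFn {R : Type*} [CommRing R] [DecidableEq R] {n : ℕ} (c : Fin n → R) :
    ∑ i, C (c i) * X ^ (i : ℕ) = ofFn n c := by
  rw [ofFn_eq_sum_monomial]
  exact Finset.sum_congr rfl fun i _ => C_mul_X_pow_eq_monomial

theorem eq_sum_C_mul_X_pow {R : Type*} [CommRing R] {n : ℕ} {r : R[X]} (hr : r.degree < n) :
    r = ∑ i : Fin n, C (r.coeff i) * X ^ (i : ℕ) := by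
  rw [Fin.sum_univ_eq_sum_range fun i => C (r.coeff i) * X ^ i]
  rcases eq_or_ne r 0 with rfl | h0
  · simp
  · exact r.as_sum_range_C_mul_X_pow' ((natDegree_lt_iff_degree_lt h0).2 hr)

theorem dvd_of_chain {R : Type*} [CommMonoid R] {f : ℕ → R} {m : ℕ}
    (hchain : ∀ i < m, f (i + 1) ∣ f i) {i j : ℕ} (hij : i ≤ j) (hj : j ≤ m) : f j ∣ f i := by
  induction j, hij using Nat.le_induction with
  | base => exact dvd_rfl
  | succ n hn ih => exact (hchain n (by omega)).trans (ih (by omega))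

/-! ### Independence modulo `p` -/

/-- If `g f₀ + ∑ g_j h_j f_{j+1} = 0` with `f_m ∣ ⋯ ∣ f₀`, `h_j f_j = P` separable and
`deg g_j < deg f_j - deg f_{j+1}`, then all the coefficients vanish. -/
theorem eq_zero_of_chain_relation {K : Type*} [Field K] {P : K[X]} (hP : P.Separable)
    (f h : ℕ → K[X]) (m : ℕ) (hchain : ∀ i < m, f (i + 1) ∣ f i)
    (hh : ∀ i ≤ m, h i * f i = P) (g₀ : K[X]) (g : ℕ → K[X])
    (hg : ∀ j < m, (g j).degree < ((f j).natDegree - (f (j + 1)).natDegree : ℕ))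
    (hrel : g₀ * f 0 + ∑ j ∈ Finset.range m, g j * (h j * f (j + 1)) = 0) :
    g₀ = 0 ∧ ∀ j < m, g j = 0 := by
  have hf0 : ∀ i ≤ m, f i ≠ 0 := fun i hi h0 => hP.ne_zero (by rw [← hh i hi, h0, mul_zero])
  induction m with
  | zero =>
    simp only [Finset.range_zero, Finset.sum_empty, add_zero] at hrel
    exact ⟨(mul_eq_zero.1 hrel).resolve_right (hf0 0 le_rfl), by simp⟩
  | succ m ih =>
    have hdvd : ∀ i ≤ m, f m ∣ f i := fun i hi => dvd_of_chain hchain hi (Nat.le_succ m)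
    rw [Finset.sum_range_succ, ← add_assoc] at hrel
    obtain ⟨q, hq⟩ := hchain m (by omega)
    have hfm1 := hf0 (m + 1) le_rfl
    have hfm := hf0 m (by omega)
    have hq0 : q ≠ 0 := by
      rintro rfl
      exact hfm (by rw [hq, mul_zero])
    -- Every term except the last contains some `f i` with `i ≤ m`, hence a multiple of `f m`; the
    -- last term is thereby forced to be one too.
    have hd : f m ∣ g₀ * f 0 + ∑ j ∈ Finset.range m, g j * (h j * f (j + 1)) := by
      refine dvd_add ((hdvd 0 (by omega)).mul_left _) (Finset.dvd_sum fun j hj => ?_)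
      exact ((hdvd (j + 1) (by simpa using hj)).mul_left _).mul_left _
    have hd' : f m ∣ g m * (h m * f (m + 1)) := (dvd_add_right hd).1 (hrel ▸ dvd_zero _)
    rw [hq, mul_comm (f (m + 1)), ← mul_assoc, mul_dvd_mul_iff_right hfm1] at hd'
    -- Here `q = f_m / f_{m+1}`, and `q * h m` divides the separable `P`. So `q` must divide `g m`,
    -- whose degree is less than `deg q`.
    have hcop : IsCoprime q (h m) := by
      refine Separable.isCoprime (hP.of_dvd ⟨f (m + 1), ?_⟩)
      rw [← hh m (by omega), hq]
      ring
    have hgm : g m = 0 := by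
      refine eq_zero_of_dvd_of_degree_lt (hcop.dvd_of_dvd_mul_right hd') ?_
      have h1 := hg m (by omega)
      rwa [hq, natDegree_mul hfm1 hq0, Nat.add_sub_cancel_left, ← degree_eq_natDegree hq0] at h1
    rw [hgm, zero_mul, add_zero] at hrel
    obtain ⟨h1, h2⟩ := ih (fun i hi => hchain i (by omega)) (fun i hi => hh i (by omega))
      (fun j hj => hg j (by omega)) hrel (fun i hi => hf0 i (by omega))
    refine ⟨h1, fun j hj => ?_⟩
    rcases Nat.lt_succ_iff_lt_or_eq.1 hj with h | rfl
    exacts [h2 j h, hgm]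

/-! ### Chains of divisors of `x^β - 1` -/

/-- A chain `f_{k-1} ∣ ⋯ ∣ f₀ ∣ x^β - 1` of polynomials over `ℤ/p^k` with unit leading
coefficients, together with the cofactors `h_j f_j = x^β - 1`. -/
structure IsDivisorChain (p k β : ℕ) (f h : ℕ → (ZMod (p ^ k))[X]) : Prop where
  coprime : Nat.Coprime β p
  lead : ∀ i < k, IsUnit (f i).leadingCoeff
  dvd : ∀ i, i + 1 < k → f (i + 1) ∣ f i
  mul_eq : ∀ j < k, h j * f j = X ^ β - 1

/-- `f_s + p f_{s+1} + ⋯ + p^(k-1-s) f_{k-1}`. -/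
noncomputable def padicTail (p k : ℕ) (f : ℕ → (ZMod (p ^ k))[X]) (s : ℕ) : (ZMod (p ^ k))[X] :=
  ∑ l ∈ Finset.range (k - s), (p : (ZMod (p ^ k))[X]) ^ l * f (s + l)

theorem padicTail_zero (p k : ℕ) (f : ℕ → (ZMod (p ^ k))[X]) :
    padicTail p k f 0 = padicSum p k f := by
  simp [padicTail, padicSum]

/-- The indices of the generators of the code lying over `(b, f)`. -/
abbrev TailIndex (k β : ℕ) (t : ℕ → ℕ) : Type :=
  Fin (β - t 0) ⊕ (Σ j : Fin (k - 1), Fin (t j - t (j + 1)))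

/-- The generator with index `x` has order `p^(k - tailLevel x)`. -/
def tailLevel {k β : ℕ} {t : ℕ → ℕ} : TailIndex k β t → ℕ
  | .inl _ => 0
  | .inr x => x.1 + 1

/-- The generator with index `x` is `tailMul h x ⋆ (b, f)`. -/
noncomputable def tailMul {R : Type*} [CommRing R] {k β : ℕ} {t : ℕ → ℕ} (h : ℕ → R[X]) :
    TailIndex k β t → R[X]
  | .inl i => X ^ (i : ℕ)
  | .inr x => X ^ (x.2 : ℕ) * h x.1

/-- The polynomial of degree less than `β` congruent to `p^(- tailLevel x) (tailMul h x) f`. -/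
noncomputable def tailWord {p k β : ℕ} {t : ℕ → ℕ} (f h : ℕ → (ZMod (p ^ k))[X]) :
    TailIndex k β t → (ZMod (p ^ k))[X]
  | .inl i => X ^ (i : ℕ) * padicTail p k f 0
  | .inr x => X ^ (x.2 : ℕ) * (h x.1 * padicTail p k f (x.1 + 1))

theorem tailLevel_lt {k β : ℕ} {t : ℕ → ℕ} [NeZero k] (x : TailIndex k β t) : tailLevel x < k := by
  rcases x with i | ⟨j, i⟩
  · exact Nat.pos_of_ne_zero (NeZero.ne k)
  · have := j.2
    simp only [tailLevel]
    omega

/-- Regroups scalar coefficients into polynomials of bounded degree, the form in which repeated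
division delivers them. -/
theorem sum_C_mul_tailMul {R : Type*} [CommRing R] {k β : ℕ} {t : ℕ → ℕ} (h : ℕ → R[X])
    (c : TailIndex k β t → R) :
    ∑ x, C (c x) * tailMul h x = (∑ i : Fin (β - t 0), C (c (.inl i)) * X ^ (i : ℕ)) +
      ∑ j : Fin (k - 1), (∑ i : Fin (t j - t (j + 1)), C (c (.inr ⟨j, i⟩)) * X ^ (i : ℕ)) * h j := by
  rw [Fintype.sum_sum_type, Fintype.sum_sigma]
  congr 1
  refine Finset.sum_congr rfl fun j _ => ?_
  rw [Finset.sum_mul]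
  exact Finset.sum_congr rfl fun i _ => (mul_assoc _ _ _).symm

namespace IsDivisorChain

variable {p k β : ℕ} {f h : ℕ → (ZMod (p ^ k))[X]}

theorem pos [Fact p.Prime] (H : IsDivisorChain p k β f h) : 0 < β := by
  rcases Nat.eq_zero_or_pos β with rfl | h0
  · exact absurd ((Nat.coprime_zero_left p).1 H.coprime) (Fact.out : p.Prime).ne_one
  · exact h0

theorem monic [Fact p.Prime] (H : IsDivisorChain p k β f h) :
    (X ^ β - 1 : (ZMod (p ^ k))[X]).Monic :=
  monic_X_pow_sub_C 1 H.pos.ne'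

theorem separable [Fact p.Prime] (H : IsDivisorChain p k β f h) :
    (X ^ β - 1 : (ZMod p)[X]).Separable := by
  rw [X_pow_sub_one_separable_iff, Ne, ZMod.natCast_eq_zero_iff]
  intro hd
  exact (Fact.out : p.Prime).ne_one (Nat.eq_one_of_dvd_coprimes H.coprime hd dvd_rfl)

theorem dvd_of_le (H : IsDivisorChain p k β f h) {i j : ℕ} (hij : i ≤ j) (hj : j < k) :
    f j ∣ f i :=
  dvd_of_chain (m := k - 1) (fun i hi => H.dvd i (by omega)) hij (by omega)

section
variable [Nontrivial (ZMod (p ^ k))]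

theorem ne_zero (H : IsDivisorChain p k β f h) {j : ℕ} (hj : j < k) : f j ≠ 0 := fun h0 => by
  simpa [h0] using H.lead j hj

theorem natDegree_le (H : IsDivisorChain p k β f h) {i j : ℕ} (hij : i ≤ j) (hj : j < k) :
    (f j).natDegree ≤ (f i).natDegree :=
  natDegree_le_of_dvd_of_isUnit (H.lead j hj) (H.ne_zero (hij.trans_lt hj)) (H.dvd_of_le hij hj)

theorem natDegree_padicTail_le (H : IsDivisorChain p k β f h) {s : ℕ} :
    (padicTail p k f s).natDegree ≤ (f s).natDegree := by
  refine natDegree_sum_le_of_forall_le _ _ fun l hl => ?_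
  have hl' := Finset.mem_range.1 hl
  rw [← Nat.cast_pow]
  refine natDegree_mul_le.trans ?_
  rw [natDegree_natCast, zero_add]
  exact H.natDegree_le (Nat.le_add_right s l) (by omega)

/-- The next cofactor is a multiple of the previous one. -/
theorem exists_cofactor_succ (H : IsDivisorChain p k β f h) {j : ℕ} (hj : j + 1 < k) :
    ∃ q : (ZMod (p ^ k))[X], h (j + 1) = q * h j ∧ IsUnit q.leadingCoeff ∧
      q.natDegree = (f j).natDegree - (f (j + 1)).natDegree := by
  obtain ⟨q, hq⟩ := H.dvd j hj
  have hq' : IsUnit q.leadingCoeff :=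
    isUnit_leadingCoeff_of_mul (H.lead _ hj) (by rw [mul_comm, ← hq]; exact H.lead j (by omega))
  refine ⟨q, ?_, hq', ?_⟩
  · rw [← sub_eq_zero]
    refine eq_zero_of_mul_eq_zero_of_isUnit (H.lead _ hj) ?_
    rw [sub_mul, H.mul_eq _ hj, ← H.mul_eq j (by omega), hq]
    ring
  · have hq0 : q ≠ 0 := fun h0 => by simp [h0] at hq'
    rw [hq, mul_comm, natDegree_mul_of_isUnit (H.lead _ hj) hq0, Nat.add_sub_cancel]

variable [Fact p.Prime]

theorem lead_cofactor (H : IsDivisorChain p k β f h) {j : ℕ} (hj : j < k) :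
    IsUnit (h j).leadingCoeff := by
  refine isUnit_leadingCoeff_of_mul (H.lead j hj) ?_
  rw [H.mul_eq j hj, H.monic.leadingCoeff]
  exact isUnit_one

theorem cofactor_ne_zero (H : IsDivisorChain p k β f h) {j : ℕ} (hj : j < k) : h j ≠ 0 :=
  fun h0 => by simpa [h0] using H.lead_cofactor hj

theorem natDegree_cofactor_add (H : IsDivisorChain p k β f h) {j : ℕ} (hj : j < k) :
    (h j).natDegree + (f j).natDegree = β := by
  rw [← natDegree_mul_of_isUnit (H.lead j hj) (H.cofactor_ne_zero hj), H.mul_eq j hj]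
  exact natDegree_X_pow_sub_C (r := (1 : ZMod (p ^ k)))

/-- Repeated division by the cofactors. -/
theorem exists_eq_sum_cofactor (H : IsDivisorChain p k β f h) (u : (ZMod (p ^ k))[X])
    {m : ℕ} (hm : m < k) :
    ∃ (r₀ : (ZMod (p ^ k))[X]) (r : ℕ → (ZMod (p ^ k))[X]) (Q : (ZMod (p ^ k))[X]),
      r₀.degree < (β - (f 0).natDegree : ℕ) ∧
      (∀ j < m, (r j).degree < ((f j).natDegree - (f (j + 1)).natDegree : ℕ)) ∧
      u = r₀ + ∑ j ∈ Finset.range m, r j * h j + Q * h m := by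
  induction m with
  | zero =>
    obtain ⟨Q, r₀, hu, hr⟩ := exists_eq_mul_add_degree_lt (H.lead_cofactor hm) u
    refine ⟨r₀, 0, Q, ?_, by simp, by simpa [add_comm] using hu⟩
    rwa [show β - (f 0).natDegree = (h 0).natDegree by
      have := H.natDegree_cofactor_add hm; omega]
  | succ m ih =>
    obtain ⟨r₀, r, Q, h₀, hr, hu⟩ := ih (by omega)
    obtain ⟨q, hq, hq', hdeg⟩ := H.exists_cofactor_succ hm
    -- The divisor is `q = h_{m+1} / h_m`, of degree `deg f_m - deg f_{m+1}`: the remainder has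
    -- exactly as many coefficients as S_m has shifts.
    obtain ⟨Q', s, hQ, hs⟩ := exists_eq_mul_add_degree_lt hq' Q
    refine ⟨r₀, Function.update r m s, Q', h₀, fun j hj => ?_, ?_⟩
    · rcases eq_or_ne j m with rfl | hne
      · rwa [Function.update_self, ← hdeg]
      · rw [Function.update_of_ne hne]
        exact hr j (by omega)
    · rw [Finset.sum_range_succ, Function.update_self, Finset.sum_congr rfl fun j hj => by
        rw [Function.update_of_ne (Finset.mem_range.1 hj).ne], hq, hu, hQ]
      ring

/-- The sum corresponds to words of T₂ and the S_j; the leftover multiple of `h (k - 1)` annihilates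
`f` and is absorbed by `(a, 0)`. -/
theorem exists_eq_sum_tailMul [NeZero k] (H : IsDivisorChain p k β f h) (u : (ZMod (p ^ k))[X]) :
    ∃ (c : TailIndex k β (fun i => (f i).natDegree) → ZMod (p ^ k)) (Q : (ZMod (p ^ k))[X]),
      u = ∑ x, C (c x) * tailMul h x + Q * h (k - 1) := by
  have hk := NeZero.ne k
  obtain ⟨r₀, r, Q, h₀, hr, hu⟩ := H.exists_eq_sum_cofactor u (m := k - 1) (by omega)
  refine ⟨Sum.elim (fun i => r₀.coeff i) fun x => (r x.1).coeff x.2, Q, ?_⟩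
  rw [sum_C_mul_tailMul, hu]
  congr 2
  · exact eq_sum_C_mul_X_pow h₀
  · rw [← Fin.sum_univ_eq_sum_range fun j => r j * h j]
    refine Finset.sum_congr rfl fun j _ => ?_
    congr 1
    exact eq_sum_C_mul_X_pow (hr j j.2)

/-- For a word of S_j the degree is at most `i + (β - t_j) + t_{j+1}` with `i < t_j - t_{j+1}`.
Nothing wraps around, so a relation modulo `x^β - 1` becomes an identity of polynomials. -/
theorem degree_tailWord_lt [NeZero k] (H : IsDivisorChain p k β f h)
    (x : TailIndex k β (fun i => (f i).natDegree)) : (tailWord f h x).degree < β := by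
  have hk := NeZero.ne k
  refine (degree_le_natDegree).trans_lt (Nat.cast_lt.2 ?_)
  rcases x with i | ⟨j, i⟩
  · have := H.natDegree_padicTail_le (s := 0)
    have hi := i.2
    refine natDegree_mul_le.trans_lt ?_
    rw [natDegree_X_pow]
    simp only at hi ⊢
    omega
  · have := H.natDegree_padicTail_le (s := j + 1)
    have hi := i.2
    have hj := j.2
    have := H.natDegree_cofactor_add (j := j) (by omega)
    refine natDegree_mul_le.trans_lt ?_
    rw [natDegree_X_pow]
    have := natDegree_mul_le (p := h j) (q := padicTail p k f (j + 1))
    simp only at hi ⊢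
    omega

end

/-- For `i ≤ j`, `f_j ∣ f_i` makes `h_j f_i` a multiple of `h_j f_j = x^β - 1`; the surviving terms
of `f` share the factor `p^(j+1)`. At `j = k - 1` this factor is zero. -/
theorem cofactor_mul_padicSum (H : IsDivisorChain p k β f h) {j : ℕ} (hj : j < k) :
    (X ^ β - 1 : (ZMod (p ^ k))[X]) ∣
      h j * padicSum p k f - C ((p : ZMod (p ^ k)) ^ (j + 1)) * (h j * padicTail p k f (j + 1)) := by
  have e : padicSum p k f = ∑ i ∈ Finset.range (j + 1), (p : (ZMod (p ^ k))[X]) ^ i * f i +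
      (p : (ZMod (p ^ k))[X]) ^ (j + 1) * padicTail p k f (j + 1) := by
    have hk : k = j + 1 + (k - (j + 1)) := by omega
    rw [padicSum, congrArg Finset.range hk, Finset.sum_range_add, padicTail, Finset.mul_sum]
    congr 1
    refine Finset.sum_congr rfl fun l _ => ?_
    rw [pow_add _ (j + 1) l, mul_assoc]
  have e' : h j * padicSum p k f
      - C ((p : ZMod (p ^ k)) ^ (j + 1)) * (h j * padicTail p k f (j + 1))
      = ∑ i ∈ Finset.range (j + 1), h j * ((p : (ZMod (p ^ k))[X]) ^ i * f i) := by
    rw [e, C_pow, ← Finset.mul_sum, map_natCast C]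
    ring
  rw [e', ← H.mul_eq j hj]
  refine Finset.dvd_sum fun i hi => mul_dvd_mul_left _ ?_
  exact (H.dvd_of_le (Nat.lt_succ_iff.1 (Finset.mem_range.1 hi)) hj).mul_left _

/-- The last cofactor annihilates `f`. -/
theorem dvd_last_cofactor_mul_padicSum [NeZero k] (H : IsDivisorChain p k β f h) :
    (X ^ β - 1 : (ZMod (p ^ k))[X]) ∣ h (k - 1) * padicSum p k f := by
  have hk := NeZero.ne k
  have := H.cofactor_mul_padicSum (j := k - 1) (by omega)
  rwa [Nat.sub_add_cancel (by omega), natCast_pow_self_eq_zero, C_0, zero_mul, sub_zero] at this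

theorem dvd_tailMul_mul_padicSum_sub (H : IsDivisorChain p k β f h)
    (x : TailIndex k β (fun i => (f i).natDegree)) :
    (X ^ β - 1 : (ZMod (p ^ k))[X]) ∣
      tailMul h x * padicSum p k f - C ((p : ZMod (p ^ k)) ^ tailLevel x) * tailWord f h x := by
  rcases x with i | ⟨j, i⟩
  · simp [tailMul, tailWord, tailLevel, padicTail_zero]
  · refine ((H.cofactor_mul_padicSum (j := j) (by omega)).mul_left (X ^ (i : ℕ))).trans ?_
    refine (dvd_of_eq ?_)
    simp only [tailMul, tailWord, tailLevel]
    ring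

theorem map_padicTail [NeZero k] {s : ℕ} (hs : s < k) :
    (padicTail p k f s).map (modP p k) = (f s).map (modP p k) := by
  rw [padicTail, Polynomial.map_sum, Finset.sum_eq_single 0]
  · simp
  · intro l _ hl
    rw [Polynomial.map_mul, Polynomial.map_pow, Polynomial.map_natCast, CharP.cast_eq_zero,
      zero_pow hl, zero_mul]
  · intro h0
    exact absurd (Finset.mem_range.2 (by omega)) h0

variable [Fact p.Prime] [NeZero k]

theorem natDegree_map (H : IsDivisorChain p k β f h) {j : ℕ} (hj : j < k) :
    ((f j).map (modP p k)).natDegree = (f j).natDegree :=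
  natDegree_map_of_leadingCoeff_ne_zero _ ((H.lead j hj).map (modP p k)).ne_zero

/-- Modulo `p` each tail collapses to its first term, which leaves exactly the polynomials of
`eq_zero_of_chain_relation`. -/
theorem linearIndependent_map_tailWord (H : IsDivisorChain p k β f h) :
    LinearIndependent (ZMod p) fun x : TailIndex k β (fun i => (f i).natDegree) =>
      (tailWord f h x).map (modP p k) := by
  have hk := NeZero.ne k
  rw [Fintype.linearIndependent_iff]
  intro c hc
  rw [Fintype.sum_sum_type, Fintype.sum_sigma] at hc
  let g : ℕ → (ZMod p)[X] := fun j =>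
    if hj : j < k - 1 then ofFn _ fun i => c (.inr ⟨⟨j, hj⟩, i⟩) else 0
  have hg : ∀ j : Fin (k - 1), g j = ofFn _ fun i => c (.inr ⟨j, i⟩) := fun j => dif_pos j.2
  have key := eq_zero_of_chain_relation H.separable (fun j => (f j).map (modP p k))
    (fun j => (h j).map (modP p k)) (k - 1)
    (fun i hi => Polynomial.map_dvd _ (H.dvd i (by omega)))
    (fun i hi => by
      rw [← Polynomial.map_mul, H.mul_eq i (by omega)]
      simp)
    (ofFn _ fun i => c (.inl i)) g
    (fun j hj => by
      rw [H.natDegree_map (by omega), H.natDegree_map (by omega), hg ⟨j, hj⟩]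
      exact ofFn_degree_lt _)
    (by
      rw [← hc, ← Fin.sum_univ_eq_sum_range fun j =>
        g j * ((h j).map (modP p k) * (f (j + 1)).map (modP p k))]
      congr 1
      · rw [← sum_C_mul_X_pow_eq_ofFn, Finset.sum_mul]
        refine Finset.sum_congr rfl fun i _ => ?_
        simp only [tailWord, Polynomial.map_mul, Polynomial.map_pow, map_X, smul_eq_C_mul]
        rw [map_padicTail (by omega), mul_assoc]
      · refine Finset.sum_congr rfl fun j _ => ?_
        rw [hg, ← sum_C_mul_X_pow_eq_ofFn, Finset.sum_mul]
        refine Finset.sum_congr rfl fun i _ => ?_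
        simp only [tailWord, Polynomial.map_mul, Polynomial.map_pow, map_X, smul_eq_C_mul]
        rw [map_padicTail (by omega), mul_assoc])
  rintro (i | ⟨j, i⟩)
  · exact congrFun (injective_ofFn _ (key.1.trans (map_zero (ofFn _)).symm)) i
  · have h1 := key.2 j j.2
    rw [hg] at h1
    exact congrFun (injective_ofFn _ (h1.trans (map_zero (ofFn _)).symm)) i

variable [Nontrivial (ZMod (p ^ k))]

/-- The relations between the second components of the generators. -/
theorem pow_dvd_of_dvd_sum_mul_padicSum (H : IsDivisorChain p k β f h)
    (c : TailIndex k β (fun i => (f i).natDegree) → ZMod (p ^ k))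
    (hc : (X ^ β - 1 : (ZMod (p ^ k))[X]) ∣ (∑ x, C (c x) * tailMul h x) * padicSum p k f)
    (x : TailIndex k β (fun i => (f i).natDegree)) :
    (p : ZMod (p ^ k)) ^ (k - tailLevel x) ∣ c x := by
  have hp : p.Prime := Fact.out
  -- Modulo `x^β - 1`, each product with `f` is replaced by `p^(tailLevel x)` times its low-degree
  -- word.
  have h1 : (X ^ β - 1 : (ZMod (p ^ k))[X]) ∣
      ∑ x, (c x * (p : ZMod (p ^ k)) ^ tailLevel x) • tailWord f h x := by
    rw [← dvd_sub_right hc, Finset.sum_mul, ← Finset.sum_sub_distrib]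
    refine Finset.dvd_sum fun x _ => ?_
    refine ((H.dvd_tailMul_mul_padicSum_sub x).mul_left (C (c x))).trans (dvd_of_eq ?_)
    rw [smul_eq_C_mul, C_mul]
    ring
  have h2 : ∑ x, (c x * (p : ZMod (p ^ k)) ^ tailLevel x) • tailWord f h x = 0 := by
    by_contra hne
    refine H.monic.not_dvd_of_degree_lt hne ?_ h1
    rw [show (X ^ β - 1 : (ZMod (p ^ k))[X]).degree = β from degree_X_pow_sub_C H.pos 1]
    refine (degree_sum_le _ _).trans_lt ((Finset.sup_lt_iff (WithBot.bot_lt_coe β)).2 fun x _ => ?_)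
    exact (degree_smul_le _ _).trans_lt (H.degree_tailWord_lt x)
  have h3 := Fintype.linearIndependent_iff.1
    (linearIndependent_of_map_modP hp.pos H.linearIndependent_map_tailWord) _ h2 x
  exact pow_dvd_of_pow_mul_eq_zero hp.pos (tailLevel_lt x).le (by rw [mul_comm, h3])

end IsDivisorChain

/-! ### The generators of the code -/

theorem redPoly_C {p k : ℕ} [k.AtLeastTwo] (c : ZMod (p ^ k)) :
    redPoly p k (C c) = C (modP p k c) :=
  Polynomial.map_C _

theorem cyc_eq_zero_iff {q n : ℕ} (u : (ZMod q)[X]) : cyc q n u = 0 ↔ X ^ n - 1 ∣ u :=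
  Ideal.Quotient.eq_zero_iff_dvd _ _

namespace MixedSpace

variable {p k α β : ℕ}

theorem word_add (u u' : (ZMod p)[X]) (v v' : (ZMod (p ^ k))[X]) :
    (word u v + word u' v' : MixedSpace p k α β) = word (u + u') (v + v') :=
  Prod.ext (map_add (cyc p α) u u').symm (map_add (cyc (p ^ k) β) v v').symm

theorem word_eq_zero_iff (u : (ZMod p)[X]) (v : (ZMod (p ^ k))[X]) :
    (word u v : MixedSpace p k α β) = 0 ↔ X ^ α - 1 ∣ u ∧ X ^ β - 1 ∣ v := by
  rw [← cyc_eq_zero_iff, ← cyc_eq_zero_iff]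
  exact Prod.ext_iff

variable [k.AtLeastTwo]

theorem smul_word (g : (ZMod (p ^ k))[X]) (u : (ZMod p)[X]) (v : (ZMod (p ^ k))[X]) :
    (g • word u v : MixedSpace p k α β) = word (redPoly p k g * u) (g * v) :=
  Prod.ext (map_mul (cyc p α) _ _).symm (map_mul (cyc (p ^ k) β) _ _).symm

theorem const_smul_eq (c : ZMod (p ^ k)) (w : MixedSpace p k α β) : c • w = (C c) • w := rfl

end MixedSpace

open MixedSpace

/-- The indices of the words in the spanning set; `ta`, `t` are the degrees of `a`, `f`. -/
abbrev GenIndex (k α β ta : ℕ) (t : ℕ → ℕ) : Type := Fin (α - ta) ⊕ TailIndex k β t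

/-- The words in the spanning set. -/
noncomputable def gen {p k α β : ℕ} [k.AtLeastTwo] (a b : (ZMod p)[X])
    (f h : ℕ → (ZMod (p ^ k))[X]) :
    GenIndex k α β a.natDegree (fun i => (f i).natDegree) → MixedSpace p k α β
  | .inl i => (X ^ (i : ℕ) : (ZMod (p ^ k))[X]) • word a 0
  | .inr x => tailMul h x • word b (padicSum p k f)

/-- The generator with index `x` has order `p^(genExp x)`. -/
def genExp {k α β ta : ℕ} {t : ℕ → ℕ} : GenIndex k α β ta t → ℕ
  | .inl _ => 1
  | .inr x => k - tailLevel x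

theorem one_le_genExp {k α β ta : ℕ} {t : ℕ → ℕ} [NeZero k] (x : GenIndex k α β ta t) :
    1 ≤ genExp x := by
  rcases x with i | x
  · exact le_rfl
  · have := tailLevel_lt x
    simp only [genExp]
    omega

theorem genExp_le {k α β ta : ℕ} {t : ℕ → ℕ} [NeZero k] (x : GenIndex k α β ta t) :
    genExp x ≤ k := by
  rcases x with i | x
  · exact Nat.pos_of_ne_zero (NeZero.ne k)
  · exact Nat.sub_le _ _

section
variable {p k α β : ℕ} [k.AtLeastTwo] {a b : (ZMod p)[X]} {f h : ℕ → (ZMod (p ^ k))[X]}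

theorem range_gen : Set.range (gen (α := α) (β := β) a b f h) = spanningSet p k α β a b f h := by
  ext w
  constructor
  · rintro ⟨i | i | ⟨j, i⟩, rfl⟩
    · exact Or.inl (Or.inl ⟨i, i.2, rfl⟩)
    · exact Or.inl (Or.inr ⟨i, i.2, rfl⟩)
    · refine Or.inr (Set.mem_biUnion (Finset.mem_coe.2 (Finset.mem_range.2 j.2)) ⟨i, i.2, ?_⟩)
      rw [← smul_word, ← mul_smul]
      rfl
  · rintro ((⟨i, hi, rfl⟩ | ⟨i, hi, rfl⟩) | hw)
    · exact ⟨.inl ⟨i, hi⟩, rfl⟩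
    · exact ⟨.inr (.inl ⟨i, hi⟩), rfl⟩
    · obtain ⟨j, hj, i, hi, rfl⟩ := Set.mem_iUnion₂.1 hw
      refine ⟨.inr (.inr ⟨⟨j, Finset.mem_range.1 hj⟩, ⟨i, hi⟩⟩), ?_⟩
      rw [← smul_word, ← mul_smul]
      rfl

/-- One polynomial multiplies both `b` and `f`, so a vanishing second component controls the
contribution of `b` to the first. -/
theorem sum_smul_gen (c : GenIndex k α β a.natDegree (fun i => (f i).natDegree) → ZMod (p ^ k)) :
    ∑ x, c x • gen a b f h x =
      (word (redPoly p k (∑ i : Fin (α - a.natDegree), C (c (.inl i)) * X ^ (i : ℕ)) * a +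
          redPoly p k (∑ x, C (c (.inr x)) * tailMul h x) * b)
        ((∑ x, C (c (.inr x)) * tailMul h x) * padicSum p k f) : MixedSpace p k α β) := by
  have h1 : ∑ x, c x • gen a b f h x =
      ((∑ i : Fin (α - a.natDegree), C (c (.inl i)) * X ^ (i : ℕ)) • word a 0 +
        (∑ x, C (c (.inr x)) * tailMul h x) • word b (padicSum p k f) : MixedSpace p k α β) := by
    rw [Fintype.sum_sum_type, Finset.sum_smul, Finset.sum_smul]
    simp only [const_smul_eq, gen, mul_smul]
  rw [h1, smul_word, smul_word, word_add, mul_zero, zero_add]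

theorem gen_mem_cyclicCode (x : GenIndex k α β a.natDegree (fun i => (f i).natDegree)) :
    gen a b f h x ∈ cyclicCode p k α β a b (padicSum p k f) := by
  have h1 : word a 0 ∈ cyclicCode p k α β a b (padicSum p k f) :=
    Submodule.subset_span (Or.inl rfl)
  have h2 : word b (padicSum p k f) ∈ cyclicCode p k α β a b (padicSum p k f) :=
    Submodule.subset_span (Or.inr rfl)
  rcases x with i | x
  · exact (cyclicCode p k α β a b (padicSum p k f)).smul_mem _ h1
  · exact (cyclicCode p k α β a b (padicSum p k f)).smul_mem _ h2

variable [Fact p.Prime]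

theorem natDegree_le_of_dvd_X_pow_sub_one (hα : 0 < α) (ha : a ∣ X ^ α - 1) :
    a ≠ 0 ∧ a.natDegree ≤ α := by
  have h0 : (X ^ α - 1 : (ZMod p)[X]) ≠ 0 := (monic_X_pow_sub_C 1 hα.ne').ne_zero
  refine ⟨ne_zero_of_dvd_ne_zero h0 ha, (natDegree_le_of_dvd ha h0).trans_eq ?_⟩
  exact natDegree_X_pow_sub_C (r := (1 : ZMod p))

/-- The product has degree less than `α`, so divisibility by `x^α - 1` forces it to be zero. -/
theorem eq_zero_of_dvd_ofFn_mul (hα : 0 < α) (ha : a ∣ X ^ α - 1)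
    {d : Fin (α - a.natDegree) → ZMod p} (hd : X ^ α - 1 ∣ ofFn _ d * a) : d = 0 := by
  obtain ⟨ha0, hle⟩ := natDegree_le_of_dvd_X_pow_sub_one hα ha
  refine injective_ofFn _ (Eq.trans ?_ (map_zero (ofFn _)).symm)
  by_contra hne
  refine hne ((mul_eq_zero.1 (eq_zero_of_dvd_of_degree_lt hd ?_)).resolve_right ha0)
  rw [show (X ^ α - 1 : (ZMod p)[X]).degree = α from degree_X_pow_sub_C hα 1, degree_mul,
    degree_eq_natDegree hne, degree_eq_natDegree ha0, ← Nat.cast_add, Nat.cast_lt]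
  have := (natDegree_lt_iff_degree_lt hne).2 (ofFn_degree_lt d)
  omega

theorem redPoly_sum_C_mul_X_pow {n : ℕ} (c : Fin n → ZMod (p ^ k)) :
    redPoly p k (∑ i, C (c i) * X ^ (i : ℕ)) = ofFn n fun i => modP p k (c i) := by
  rw [map_sum, ← sum_C_mul_X_pow_eq_ofFn]
  refine Finset.sum_congr rfl fun i _ => ?_
  rw [map_mul, redPoly_C, map_pow]
  congr 2
  exact Polynomial.map_X _

theorem modP_eq_zero_of_pow_dvd {c : ZMod (p ^ k)} {n : ℕ} (hn : 1 ≤ n)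
    (h : (p : ZMod (p ^ k)) ^ n ∣ c) : modP p k c = 0 := by
  have : NeZero (p ^ k) := ⟨pow_ne_zero _ (Fact.out : p.Prime).ne_zero⟩
  exact (modP_eq_zero_iff c).2 ((dvd_pow_self _ (by omega)).trans h)

theorem nontrivial_zmod_pow : Nontrivial (ZMod (p ^ k)) := by
  have : Fact (1 < p ^ k) := ⟨Nat.one_lt_pow (NeZero.ne k) (Fact.out : p.Prime).one_lt⟩
  infer_instance

/-- A combination of generators with vanishing second component involves `(b, f)` only through
multiples of `p`. -/
theorem redPoly_sum_tailMul_eq_zero (H : IsDivisorChain p k β f h)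
    (c : TailIndex k β (fun i => (f i).natDegree) → ZMod (p ^ k))
    (hc : (X ^ β - 1 : (ZMod (p ^ k))[X]) ∣ (∑ x, C (c x) * tailMul h x) * padicSum p k f) :
    redPoly p k (∑ x, C (c x) * tailMul h x) = 0 := by
  have := nontrivial_zmod_pow (p := p) (k := k)
  rw [map_sum]
  refine Finset.sum_eq_zero fun x _ => ?_
  have hx := tailLevel_lt x
  rw [map_mul, redPoly_C, modP_eq_zero_of_pow_dvd (by omega)
    (H.pow_dvd_of_dvd_sum_mul_padicSum c hc x), C_0, zero_mul]

/-- The exponent is at least one, which kills the `p`-ary component; in the other one, `p^(k -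
tailLevel x)` meets the factor `p^(tailLevel x)`. -/
theorem pow_genExp_smul_gen (H : IsDivisorChain p k β f h)
    (x : GenIndex k α β a.natDegree (fun i => (f i).natDegree)) :
    (p : ZMod (p ^ k)) ^ genExp x • gen a b f h x = 0 := by
  have hred : redPoly p k (C ((p : ZMod (p ^ k)) ^ genExp x)) = 0 := by
    rw [redPoly_C, modP_eq_zero_of_pow_dvd (one_le_genExp x) dvd_rfl, C_0]
  rcases x with i | x
  · rw [const_smul_eq, gen, smul_word, smul_word, hred, word_eq_zero_iff]
    simp
  · rw [const_smul_eq, gen, smul_word, smul_word, hred, word_eq_zero_iff, zero_mul]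
    refine ⟨dvd_zero _, ?_⟩
    refine ((H.dvd_tailMul_mul_padicSum_sub x).mul_left
      (C ((p : ZMod (p ^ k)) ^ genExp (.inr x : GenIndex k α β a.natDegree _)))).trans
      (dvd_of_eq ?_)
    rw [mul_sub, ← mul_assoc _ (C _) (tailWord f h x), ← C_mul, ← pow_add, genExp,
      Nat.sub_add_cancel (tailLevel_lt x).le, natCast_pow_self_eq_zero, C_0, zero_mul, sub_zero]

/-- The relations are triangular: the second component settles the coefficients over `(b, f)`, after
which `b` drops out of the first component and only multiples of `a` remain. -/
theorem pow_genExp_dvd_of_sum_eq_zero (H : IsDivisorChain p k β f h) (hα : 0 < α)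
    (ha : a ∣ X ^ α - 1)
    (c : GenIndex k α β a.natDegree (fun i => (f i).natDegree) → ZMod (p ^ k))
    (hc : ∑ x, c x • gen a b f h x = 0) (x) : (p : ZMod (p ^ k)) ^ genExp x ∣ c x := by
  have := nontrivial_zmod_pow (p := p) (k := k)
  have : NeZero (p ^ k) := ⟨pow_ne_zero _ (Fact.out : p.Prime).ne_zero⟩
  rw [sum_smul_gen, word_eq_zero_iff] at hc
  obtain ⟨h1, h2⟩ := hc
  rw [redPoly_sum_tailMul_eq_zero H _ h2, zero_mul, add_zero, redPoly_sum_C_mul_X_pow] at h1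
  rcases x with i | x
  · rw [genExp, pow_one, ← modP_eq_zero_iff]
    exact congrFun (eq_zero_of_dvd_ofFn_mul hα ha h1) i
  · exact H.pow_dvd_of_dvd_sum_mul_padicSum _ h2 x

/-- The generators span the code. -/
theorem span_range_gen (H : IsDivisorChain p k β f h) (hα : 0 < α) (ha : a ∣ X ^ α - 1)
    (hab : a ∣ redPoly p k (h (k - 1)) * b) :
    Submodule.span (ZMod (p ^ k)) (Set.range (gen (α := α) (β := β) a b f h)) =
      (cyclicCode p k α β a b (padicSum p k f)).restrictScalars (ZMod (p ^ k)) := by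
  have := nontrivial_zmod_pow (p := p) (k := k)
  set N := Submodule.span (ZMod (p ^ k)) (Set.range (gen (α := α) (β := β) a b f h)) with hN
  have hgen : ∀ x, gen a b f h x ∈ N := fun x => Submodule.subset_span ⟨x, rfl⟩
  obtain ⟨ha0, hle⟩ := natDegree_le_of_dvd_X_pow_sub_one hα ha
  have hhead : ∀ u : (ZMod p)[X], (word (u * a) 0 : MixedSpace p k α β) ∈ N := fun u => by
    obtain ⟨A, hA⟩ := ha
    have hA0 : A ≠ 0 := by
      rintro rfl
      exact (monic_X_pow_sub_C (1 : ZMod p) hα.ne').ne_zero (by rw [C_1, hA, mul_zero])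
    have hdeg : A.natDegree = α - a.natDegree := by
      have h1 := natDegree_mul ha0 hA0
      rw [← hA, show (X ^ α - 1 : (ZMod p)[X]).natDegree = α from natDegree_X_pow_sub_C (r := 1)]
        at h1
      omega
    -- Reduction modulo `A = (x^α - 1) / a` leaves `α - deg a` coefficients, one for each word of
    -- T₁; they are then lifted to `ℤ/p^k`.
    obtain ⟨q, r, hu, hr⟩ := exists_eq_mul_add_degree_lt
      (isUnit_iff_ne_zero.2 (leadingCoeff_ne_zero.2 hA0)) u
    rw [hdeg] at hr
    choose c hc using fun i : Fin (α - a.natDegree) => ZMod.ringHom_surjective (modP p k)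
      (r.coeff i)
    have h2 : (word (u * a) 0 : MixedSpace p k α β) =
        ∑ i, c i • gen a b f h (.inl i : GenIndex k α β a.natDegree _) := by
      have h3 := sum_smul_gen (α := α) (β := β) (a := a) (b := b) (f := f) (h := h)
        (Sum.elim c fun _ => 0)
      rw [Fintype.sum_sum_type] at h3
      simp only [Sum.elim_inl, Sum.elim_inr, zero_smul, Finset.sum_const_zero, add_zero,
        zero_mul, map_zero] at h3
      rw [h3, redPoly_sum_C_mul_X_pow, funext hc, ← sum_C_mul_X_pow_eq_ofFn,
        ← eq_sum_C_mul_X_pow hr]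
      refine Prod.ext ?_ rfl
      change cyc p α _ = cyc p α _
      rw [← sub_eq_zero, ← map_sub, cyc_eq_zero_iff, hA]
      exact ⟨q, by rw [hu]; ring⟩
    rw [h2]
    exact N.sum_mem fun i _ => N.smul_mem _ (hgen _)
  have htail : ∀ u : (ZMod (p ^ k))[X],
      (u • word b (padicSum p k f) : MixedSpace p k α β) ∈ N := fun u => by
    obtain ⟨c, Q, hu⟩ := H.exists_eq_sum_tailMul u
    rw [hu, add_smul, Finset.sum_smul]
    refine N.add_mem (N.sum_mem fun x _ => ?_) ?_
    · rw [mul_smul]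
      exact N.smul_mem (c x) (hgen (.inr x))
    -- The multiple of `h (k - 1)` has zero second component, and its first component is `Q̄ e a`,
    -- already covered by `hhead`.
    · obtain ⟨e, he⟩ := hab
      have h1 := hhead (redPoly p k Q * e)
      convert h1 using 1
      rw [smul_word]
      refine Prod.ext ?_ ?_
      · change cyc p α _ = cyc p α _
        rw [map_mul (redPoly p k), mul_assoc, he]
        ring_nf
      · change cyc (p ^ k) β _ = cyc (p ^ k) β 0
        rw [map_zero, cyc_eq_zero_iff, mul_assoc]
        exact H.dvd_last_cofactor_mul_padicSum.mul_left Q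
  refine le_antisymm (Submodule.span_le.2 ?_) fun w hw => ?_
  · rintro _ ⟨x, rfl⟩
    exact gen_mem_cyclicCode x
  · obtain ⟨u, v, huv⟩ := Submodule.mem_span_pair.1 ((Submodule.restrictScalars_mem _ _ _).1 hw)
    rw [← huv, smul_word u, mul_zero]
    exact N.add_mem (hhead _) (htail v)

/-- The code is a product of cyclic groups of orders `p^(genExp x)`. -/
theorem nonempty_cyclicCode_addEquiv (H : IsDivisorChain p k β f h) (hα : 0 < α)
    (ha : a ∣ X ^ α - 1) (hab : a ∣ redPoly p k (h (k - 1)) * b) :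
    Nonempty (cyclicCode p k α β a b (padicSum p k f) ≃+
      ((x : GenIndex k α β a.natDegree (fun i => (f i).natDegree)) → ZMod (p ^ genExp x))) := by
  obtain ⟨E⟩ := nonempty_span_addEquiv_pi_zmod (gen a b f h) genExp genExp_le
    (pow_genExp_smul_gen H) (pow_genExp_dvd_of_sum_eq_zero H hα ha)
  have hs : (cyclicCode p k α β a b (padicSum p k f)).toAddSubgroup = (Submodule.span
      (ZMod (p ^ k)) (Set.range (gen (α := α) (β := β) a b f h))).toAddSubgroup := by
    rw [span_range_gen H hα ha hab]
    rfl
  exact ⟨(AddEquiv.addSubgroupCongr hs).trans E⟩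

theorem isMinimalSpanningSet_spanningSet (H : IsDivisorChain p k β f h) (hα : 0 < α)
    (ha : a ∣ X ^ α - 1) (hab : a ∣ redPoly p k (h (k - 1)) * b) :
    IsMinimalSpanningSet (spanningSet p k α β a b f h)
      (cyclicCode p k α β a b (padicSum p k f)) := by
  have := nontrivial_zmod_pow (p := p) (k := k)
  rw [IsMinimalSpanningSet, ← span_range_gen H hα ha hab, ← range_gen]
  refine minimal_span_range _ fun c hc x hx => ?_
  have h0 := modP_eq_zero_of_pow_dvd (one_le_genExp x)
    (pow_genExp_dvd_of_sum_eq_zero H hα ha c hc x)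
  exact (hx.map (modP p k)).ne_zero h0

/-- If a combination of generators has zero second component, its `b` part vanishes modulo `p`. So
no codeword `(u, 0)` arises beyond the multiples of `a`, and the `x^i a` form a basis. -/
theorem finrank_pureSubcode (H : IsDivisorChain p k β f h) (hα : 0 < α)
    (ha : a ∣ X ^ α - 1) (hab : a ∣ redPoly p k (h (k - 1)) * b) :
    Module.finrank (ZMod p) (pureSubcode (cyclicCode p k α β a b (padicSum p k f))) =
      α - a.natDegree := by
  let w : Fin (α - a.natDegree) → CycRing p α := fun i => cyc p α (X ^ (i : ℕ) * a)
  have hsum : ∀ d : Fin (α - a.natDegree) → ZMod p,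
      ∑ i, d i • w i = cyc p α (ofFn _ d * a) := fun d => by
    rw [← sum_C_mul_X_pow_eq_ofFn, Finset.sum_mul, map_sum]
    refine Finset.sum_congr rfl fun i _ => ?_
    rw [mul_assoc, ← smul_eq_C_mul]
    rfl
  have hw : LinearIndependent (ZMod p) w := by
    rw [Fintype.linearIndependent_iff]
    intro d hd
    rw [hsum, cyc_eq_zero_iff] at hd
    exact congrFun (eq_zero_of_dvd_ofFn_mul hα ha hd)
  have hspan : pureSubcode (cyclicCode p k α β a b (padicSum p k f)) =
      Submodule.span (ZMod p) (Set.range w) := by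
    refine le_antisymm (fun u hu => ?_) (Submodule.span_le.2 ?_)
    · obtain ⟨q, rfl⟩ := Ideal.Quotient.mk_surjective u
      have e : ((cyc p α q, 0) : CycRing p α × CycRing (p ^ k) β) =
          (word q 0 : MixedSpace p k α β) := Prod.ext rfl (map_zero _).symm
      have h1 : (word q 0 : MixedSpace p k α β) ∈ Submodule.span (ZMod (p ^ k))
          (Set.range (gen a b f h)) := by
        rw [span_range_gen H hα ha hab, ← e]
        exact hu
      obtain ⟨c, hc⟩ := (Submodule.mem_span_range_iff_exists_fun _).1 h1
      rw [sum_smul_gen] at hc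
      have h2 := redPoly_sum_tailMul_eq_zero H _
        ((cyc_eq_zero_iff _).1 ((Prod.ext_iff.1 hc).2.trans (map_zero _)))
      have h3 := (Prod.ext_iff.1 hc).1
      rw [h2, zero_mul, add_zero, redPoly_sum_C_mul_X_pow] at h3
      refine (congrArg (· ∈ Submodule.span (ZMod p) (Set.range w))
        (h3.symm.trans (hsum _).symm)).mpr ?_
      exact Submodule.sum_mem _ fun i _ => Submodule.smul_mem _ _ (Submodule.subset_span ⟨i, rfl⟩)
    · rintro _ ⟨i, rfl⟩
      have h1 : ((X ^ (i : ℕ) : (ZMod (p ^ k))[X]) • word a 0 : MixedSpace p k α β) ∈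
          cyclicCode p k α β a b (padicSum p k f) :=
        Submodule.smul_mem _ _ (Submodule.subset_span (Or.inl rfl))
      rw [smul_word, mul_zero] at h1
      have h2 : (word (redPoly p k (X ^ (i : ℕ)) * a) 0 : MixedSpace p k α β) =
          ((w i, 0) : CycRing p α × CycRing (p ^ k) β) := by
        refine Prod.ext ?_ (map_zero _)
        change cyc p α _ = cyc p α _
        rw [map_pow, show redPoly p k X = X from Polynomial.map_X _]
      rw [h2] at h1
      exact h1
  rw [hspan, finrank_span_eq_card hw, Fintype.card_fin]

end

/-! ### The type of the code -/

/-- The indices of the cyclic factors in a group with type parameters `γ`. -/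
abbrev TypeIndex (k : ℕ) (γ : ℕ → ℕ) : Type :=
  Fin (γ 0 + γ k) ⊕ (Σ i : Fin (k - 1), Fin (γ (i + 1)))

/-- The factor with index `x` has order `p^(typeExp x)`. -/
def typeExp {k : ℕ} {γ : ℕ → ℕ} : TypeIndex k γ → ℕ
  | .inl _ => 1
  | .inr x => k - x.1

theorem one_le_typeExp {k : ℕ} {γ : ℕ → ℕ} (x : TypeIndex k γ) : 1 ≤ typeExp x := by
  rcases x with i | ⟨j, i⟩
  · exact le_rfl
  · have := j.2
    simp only [typeExp]
    omega

/-- A group with type parameters `γ` as a product over a single index type. -/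
def typeAddEquiv (p k : ℕ) (γ : ℕ → ℕ) :
    ((Fin (γ 0 + γ k) → ZMod p) ×
      ((i : Fin (k - 1)) → Fin (γ (i + 1)) → ZMod (p ^ (k - i)))) ≃+
    ((x : TypeIndex k γ) → ZMod (p ^ typeExp x)) :=
  ((AddEquiv.prodCongr (AddEquiv.piCongrRight fun _ : Fin (γ 0 + γ k) =>
    (ZMod.ringEquivCongr (pow_one p).symm).toAddEquiv)
    (LinearEquiv.piCurry ℕ (κ := fun i : Fin (k - 1) => Fin (γ (i + 1)))
      fun i _ => ZMod (p ^ (k - i))).symm.toAddEquiv)).trans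
    (LinearEquiv.sumPiEquivProdPi ℕ (Fin (γ 0 + γ k)) (Σ i : Fin (k - 1), Fin (γ (i + 1)))
      fun x => ZMod (p ^ typeExp (γ := γ) x)).symm.toAddEquiv

/-- Only `j = k - s - m` can contribute; `n + s ≤ k` keeps the truncated subtraction exact on the
range of `j`. -/
theorem sum_ite_sub_eq {n s k : ℕ} (hn : n + s ≤ k) (F : ℕ → ℕ) (m : ℕ) :
    (∑ j : Fin n, if k - (j + s) = m then F j else 0) =
      if m + s ≤ k ∧ k < n + s + m then F (k - s - m) else 0 := by
  rw [Fin.sum_univ_eq_sum_range fun j => if k - (j + s) = m then F j else 0]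
  split_ifs with h
  · rw [Finset.sum_eq_single (k - s - m)]
    · rw [if_pos (by omega)]
    · intro j hj hne
      have := Finset.mem_range.1 hj
      rw [if_neg (by omega)]
    · intro hj
      exact absurd (Finset.mem_range.2 (by omega)) hj
  · refine Finset.sum_eq_zero fun j hj => ?_
    have := Finset.mem_range.1 hj
    rw [if_neg (by omega)]

theorem count_typeExp {k : ℕ} (γ : ℕ → ℕ) (m : ℕ) :
    (∑ x : TypeIndex k γ, if typeExp x = m then 1 else 0) =
      (if m = 1 then γ 0 + γ k else 0) + if m ≤ k ∧ 1 < m then γ (k - m + 1) else 0 := by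
  rw [Fintype.sum_sum_type, Fintype.sum_sigma]
  congr 1
  · simp [typeExp, eq_comm]
  · have h1 := sum_ite_sub_eq (n := k - 1) (s := 0) (k := k) (by omega) (fun j => γ (j + 1)) m
    simp only [add_zero, Nat.sub_zero] at h1
    refine Eq.trans (Finset.sum_congr rfl fun j _ => ?_)
      (h1.trans (if_congr (by omega) rfl rfl))
    change (∑ _y : Fin (γ (j + 1)), if k - (j : ℕ) = m then 1 else 0) = _
    rw [Finset.sum_const, Finset.card_univ, Fintype.card_fin, smul_eq_mul, mul_ite, mul_one,
      mul_zero]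

theorem count_genExp {k : ℕ} (hk : 2 ≤ k) (α β ta : ℕ) (t : ℕ → ℕ) (m : ℕ) :
    (∑ x : GenIndex k α β ta t, if genExp x = m then 1 else 0) =
      (if m = 1 then α - ta else 0) + ((if m = k then β - t 0 else 0) +
        if m < k ∧ 0 < m then t (k - 1 - m) - t (k - 1 - m + 1) else 0) := by
  rw [Fintype.sum_sum_type, Fintype.sum_sum_type, Fintype.sum_sigma]
  congr 1
  · simp [genExp, eq_comm]
  congr 1
  · simp [genExp, tailLevel, eq_comm]
  · have h1 := sum_ite_sub_eq (n := k - 1) (s := 1) (k := k) (by omega)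
      (fun j => t j - t (j + 1)) m
    refine Eq.trans (Finset.sum_congr rfl fun j _ => ?_)
      (h1.trans (if_congr (by omega) rfl rfl))
    change (∑ _y : Fin (t j - t (j + 1)), if k - ((j : ℕ) + 1) = m then 1 else 0) = _
    rw [Finset.sum_const, Finset.card_univ, Fintype.card_fin, smul_eq_mul, mul_ite, mul_one,
      mul_zero]

/-- Exponent `k` reads off `γ 1`, exponent `k + 1 - i` reads off `γ i`, and exponent `1` mixes T₁
with S_{k-2}, so it yields only the sum `γ 0 + γ k`. -/
theorem count_eq_iff {k : ℕ} (hk : 2 ≤ k) (α β ta : ℕ) (t γ : ℕ → ℕ) :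
    (∀ m, (∑ x : GenIndex k α β ta t, if genExp x = m then 1 else 0) =
      ∑ x : TypeIndex k γ, if typeExp x = m then 1 else 0) ↔
    γ 1 = β - t 0 ∧ (∀ i, 2 ≤ i → i < k → γ i = t (i - 2) - t (i - 1)) ∧
      γ 0 + γ k = (α - ta) + (t (k - 2) - t (k - 1)) := by
  simp only [count_typeExp, count_genExp hk]
  constructor
  · intro h
    refine ⟨?_, fun i h2 hik => ?_, ?_⟩
    · have h1 := h k
      rw [if_neg (by omega), if_pos rfl, if_neg (by omega), if_neg (by omega), if_pos (by omega),
        show k - k + 1 = 1 by omega] at h1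
      omega
    · have h1 := h (k + 1 - i)
      rw [if_neg (by omega), if_neg (by omega), if_pos (by omega), if_neg (by omega),
        if_pos (by omega), show k - (k + 1 - i) + 1 = i by omega,
        show k - 1 - (k + 1 - i) = i - 2 by omega, show i - 2 + 1 = i - 1 by omega] at h1
      omega
    · have h1 := h 1
      rw [if_pos rfl, if_neg (by omega), if_pos (by omega), if_pos rfl, if_neg (by omega),
        show k - 1 - 1 = k - 2 by omega, show k - 2 + 1 = k - 1 by omega] at h1
      omega
  · rintro ⟨h1, h2, h3⟩ m
    rcases Nat.lt_trichotomy m 1 with hm | rfl | hm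
    · simp [show m = 0 by omega, show 0 ≠ k by omega]
    · rw [if_pos rfl, if_neg (by omega), if_pos (by omega), if_pos rfl, if_neg (by omega),
        show k - 1 - 1 = k - 2 by omega, show k - 2 + 1 = k - 1 by omega]
      omega
    · rcases Nat.lt_trichotomy m k with hmk | rfl | hmk
      · rw [if_neg (by omega), if_neg (by omega), if_pos (by omega), if_neg (by omega),
          if_pos (by omega), h2 _ (by omega) (by omega),
          show k - m + 1 - 2 = k - 1 - m by omega, show k - m + 1 - 1 = k - 1 - m + 1 by omega]
        omega
      · rw [if_neg (by omega), if_pos rfl, if_neg (by omega), if_neg (by omega),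
          if_pos (by omega), show m - m + 1 = 1 by omega]
        omega
      · rw [if_neg (by omega), if_neg (by omega), if_neg (by omega), if_neg (by omega),
          if_neg (by omega)]

/-- Both sides are products of nontrivial cyclic `p`-groups, and these are isomorphic exactly when
the multiplicities of each order agree. -/
theorem hasType_iff {p k α β : ℕ} [k.AtLeastTwo] [Fact p.Prime] {a b : (ZMod p)[X]}
    {f h : ℕ → (ZMod (p ^ k))[X]} (H : IsDivisorChain p k β f h) (hα : 0 < α)
    (ha : a ∣ X ^ α - 1) (hab : a ∣ redPoly p k (h (k - 1)) * b) (γ : ℕ → ℕ) :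
    HasType (cyclicCode p k α β a b (padicSum p k f)) γ ↔
      γ 1 = β - (f 0).natDegree ∧
      (∀ i, 2 ≤ i → i < k → γ i = (f (i - 2)).natDegree - (f (i - 1)).natDegree) ∧
      γ 0 + γ k = (α - a.natDegree) +
        ((f (k - 2)).natDegree - (f (k - 1)).natDegree) := by
  have hk : 2 ≤ k := Nat.AtLeastTwo.prop
  rw [← count_eq_iff hk α β a.natDegree fun i => (f i).natDegree]
  obtain ⟨E⟩ := nonempty_cyclicCode_addEquiv H hα ha hab
  constructor
  · rintro ⟨E'⟩
    exact count_eq_of_pi_zmod_addEquiv (Fact.out : p.Prime) one_le_genExp one_le_typeExp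
      (E.symm.trans (E'.trans (typeAddEquiv p k γ)))
  · intro hc
    obtain ⟨E'⟩ := nonempty_pi_zmod_addEquiv_of_count_eq p hc
    exact ⟨E.trans (E'.trans (typeAddEquiv p k γ).symm)⟩

theorem mainTheorem2 (p k α β : ℕ) (hp : p.Prime) [k.AtLeastTwo] (hα : 0 < α)
    (hβ : Nat.Coprime β p)
    (a b : (ZMod p)[X]) (f h : ℕ → (ZMod (p ^ k))[X])
    (ha : a ∣ X ^ α - 1)
    (hlead : ∀ i < k, IsUnit (f i).leadingCoeff)
    (hchain : ∀ i, i + 1 < k → f (i + 1) ∣ f i)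
    (hf₀ : f 0 ∣ X ^ β - 1)
    (hh : ∀ j < k, h j * f j = X ^ β - 1)
    (hab : a ∣ redPoly p k (h (k - 1)) * b) :
    -- the spanning set is minimal
    IsMinimalSpanningSet (spanningSet p k α β a b f h)
      (cyclicCode p k α β a b (padicSum p k f)) ∧
    -- the type parameters, with `γ₀` singled out as the dimension of `{u | (u, 0) ∈ C}`
    (∀ γ : ℕ → ℕ,
      (HasType (cyclicCode p k α β a b (padicSum p k f)) γ ∧
        γ 0 = Module.finrank (ZMod p)
          (pureSubcode (cyclicCode p k α β a b (padicSum p k f)))) ↔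
      (γ 0 = α - a.natDegree ∧ γ 1 = β - (f 0).natDegree ∧
        ∀ i, 2 ≤ i → i ≤ k → γ i = (f (i - 2)).natDegree - (f (i - 1)).natDegree)) ∧
    -- what the isomorphism class of `C` alone determines
    (∀ γ : ℕ → ℕ, HasType (cyclicCode p k α β a b (padicSum p k f)) γ →
      γ 1 = β - (f 0).natDegree ∧
      (∀ i, 2 ≤ i → i < k → γ i = (f (i - 2)).natDegree - (f (i - 1)).natDegree) ∧
      γ 0 + γ k = (α - a.natDegree) +
        ((f (k - 2)).natDegree - (f (k - 1)).natDegree)) := by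
  have : Fact p.Prime := ⟨hp⟩
  have hk : 2 ≤ k := Nat.AtLeastTwo.prop
  have H : IsDivisorChain p k β f h := ⟨hβ, hlead, hchain, hh⟩
  refine ⟨isMinimalSpanningSet_spanningSet H hα ha hab, fun γ => ?_,
    fun γ => (hasType_iff H hα ha hab γ).1⟩
  rw [hasType_iff H hα ha hab, finrank_pureSubcode H hα ha hab]
  constructor
  · rintro ⟨⟨h1, h2, h3⟩, h0⟩
    refine ⟨h0, h1, fun i hi hik => ?_⟩
    rcases hik.lt_or_eq with hlt | rfl
    · exact h2 i hi hlt
    -- In the case `i = k`, the known value of `γ 0` is cancelled from `γ 0 + γ k`.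
    · omega
  · rintro ⟨h0, h1, h2⟩
    refine ⟨⟨h1, fun i hi hik => h2 i hi hik.le, ?_⟩, h0⟩
    rw [h0, h2 k hk le_rfl]
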